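/- Let $\mathcal H\equiv\mathbb R^3$ be the Heisenberg group with product $(\mathbf x,y)\cdot(\mathbf a,b)=(\mathbf x+\mathbf a,\;y+b+x_1a_2)$, let $\Gamma=\{(\mathbf x,y):\mathbf x\in\mathbb Z^2,\ y\in\tfrac12\mathbb Z\}$, let $N=\mathcal H/\Gamma$ be the nilmanifold of cosets $g\Gamma$, and let $\pi:\mathcal H\to N$ be the projection. Let $$\Phi(\mathbf x,y)=\bigl(B\mathbf x,\;y+x_1^2+\tfrac12x_2^2+x_1x_2\bigr),\qquad B=\begin{pmatrix}2&1\\1&1\end{pmatrix},$$ an automorphism of $\mathcal H$, and let $f:N\to N$ be the induced diffeomorphism, $f\circ\pi=\pi\circ\Phi$. Let $v^s,v^u\in\mathbb R^2\setminus\{0\}$ be eigenvectors of $B$ for the eigenvalues $\tfrac{3-\sqrt5}2$ and $\tfrac{3+\sqrt5}2$. The vector fields $(v^s,x_2v^s_1)$, $(v^u,x_2v^u_1)$ and $(\mathbf 0,1)$ on $\mathcal H$ are invariant under right translations, so they descend to a global frame $X_s,X_u,X_c$ of $TN$. Let $E^s=\langle X_s\rangle$ and $E^{cu}=\langle X_u,X_c\rangle$.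 For $\theta\in\mathbb R$ let $R_\theta$ be the rotation by $\theta$ of $E^{cu}$ in its frame $(X_u,X_c)$, and let $F_\theta:TN\to TN$ be the linear cocycle over $f$ with $$F_\theta v=Df\,R_\theta v\ \ (v\in E^{cu}),\qquad F_\theta v=Df\,v\ \ (v\in E^s).$$ Then there is a nonempty open set $\mathcal I\subseteq[0,2\pi]$ such that for every $\theta\in\mathcal I$ there are line bundles $E^c_\theta,E^u_\theta$ with $E^c_\theta\oplus E^u_\theta=E^{cu}$ and a number $\lambda^c_\theta>0$ such that, for every continuous Riemannian metric on $N$: 1. $F_\theta$ is a continuous linear cocycle that is partially hyperbolic with the splitting $TN=E^s\oplus E^c_\theta\oplus E^u_\theta$. That is, the three line bundles are continuous and $F_\theta$-invariant, and there are $C>0$ and $0<\rho<1$ such that for all $p\in N$, $n\ge0$ and unit vectors $v^s\in E^s(p)$, $v^c\in E^c_\theta(p)$, $v^u\in E^u_\theta(p)$ one has $\|F_\theta^nv^s\|\le C\rho^n$, $1\le C\rho^n\|F_\theta^nv^u\|$, $\|F_\theta^nv^s\|\le C\rho^n\|F_\theta^nv^c\|$ and $\|F_\theta^nv^c\|\le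 C\rho^n\|F_\theta^nv^u\|$. 2. $F_\theta$ is nonuniformly hyperbolic: for Lebesgue almost every $p\in N$ and every nonzero $v\in T_pN$, the Lyapunov exponent $\lim_{n\to\infty}\frac1n\log\|F_\theta^nv\|$ exists and is nonzero. 3. The central exponent is positive: for Lebesgue almost every $p\in N$ and every nonzero $v\in E^c_\theta(p)$, $\lim_{n\to\infty}\frac1n\log\|F_\theta^nv\|=\lambda^c_\theta$. -/

import Mathlib

open Filter MeasureTheory
open scoped Manifold ContDiff Topology

noncomputable section

namespace HeisNil

/-- The Heisenberg group: `⟨x1, x2, y⟩` stands for the unipotent upper triangular matrix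
`!![1, x1, y; 0, 1, x2; 0, 0, 1]`. -/
@[ext]
structure Heis where
  x1 : ℝ
  x2 : ℝ
  y : ℝ

/-- Matrix multiplication in coordinates: `(x, y) * (a, b) = (x + a, y + b + x1 a2)`. -/
instance : Mul Heis := ⟨fun g h => ⟨g.x1 + h.x1, g.x2 + h.x2, g.y + h.y + g.x1 * h.x2⟩⟩

instance : One Heis := ⟨⟨0, 0, 0⟩⟩

instance : Inv Heis := ⟨fun g => ⟨-g.x1, -g.x2, -g.y + g.x1 * g.x2⟩⟩

theorem mul_def (g h : Heis) : g * h = ⟨g.x1 + h.x1, g.x2 + h.x2, g.y + h.y + g.x1 * h.x2⟩ := rfl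

theorem one_def : (1 : Heis) = ⟨0, 0, 0⟩ := rfl

theorem inv_def (g : Heis) : g⁻¹ = ⟨-g.x1, -g.x2, -g.y + g.x1 * g.x2⟩ := rfl

instance : Group Heis :=
  Group.ofLeftAxioms
    (fun a b c => by ext <;> simp only [mul_def] <;> ring)
    (fun a => by ext <;> simp only [mul_def, one_def] <;> ring)
    (fun a => by ext <;> simp only [mul_def, inv_def, one_def] <;> ring)

/-- The coordinate space `ℝ³`. -/
abbrev R3 : Type := ℝ × ℝ × ℝ

/-- The global coordinates `ℋ ≡ ℝ³`. -/
def coords : Heis ≃ R3 where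
  toFun g := (g.x1, g.x2, g.y)
  invFun v := ⟨v.1, v.2.1, v.2.2⟩
  left_inv _ := rfl
  right_inv _ := rfl

instance : TopologicalSpace Heis := TopologicalSpace.induced coords inferInstance

/-- The global coordinates as a homeomorphism. -/
def coordsHomeo : Heis ≃ₜ R3 := coords.toHomeomorphOfIsInducing ⟨rfl⟩

theorem continuous_x1 : Continuous Heis.x1 := continuous_fst.comp coordsHomeo.continuous

theorem continuous_x2 : Continuous Heis.x2 :=
  (continuous_fst.comp continuous_snd).comp coordsHomeo.continuous

theorem continuous_y : Continuous Heis.y :=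
  (continuous_snd.comp continuous_snd).comp coordsHomeo.continuous

instance : IsTopologicalGroup Heis where
  continuous_mul := by
    rw [← coordsHomeo.comp_continuous_iff]
    have h1 := continuous_x1
    have h2 := continuous_x2
    have h3 := continuous_y
    change Continuous fun p : Heis × Heis =>
      (p.1.x1 + p.2.x1, p.1.x2 + p.2.x2, p.1.y + p.2.y + p.1.x1 * p.2.x2)
    fun_prop
  continuous_inv := by
    rw [← coordsHomeo.comp_continuous_iff]
    have h1 := continuous_x1
    have h2 := continuous_x2
    have h3 := continuous_y
    change Continuous fun g : Heis => (-g.x1, -g.x2, -g.y + g.x1 * g.x2)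
    fun_prop

/-- The lattice `Γ = {(x, y) : x ∈ ℤ², y ∈ ½ℤ}`. -/
def lattice : Subgroup Heis where
  carrier := {g | ∃ m n k : ℤ, g = ⟨m, n, k / 2⟩}
  mul_mem' := by
    rintro _ _ ⟨m, n, k, rfl⟩ ⟨m', n', k', rfl⟩
    refine ⟨m + m', n + n', k + k' + 2 * (m * n'), ?_⟩
    ext <;> simp only [mul_def] <;> push_cast <;> ring
  one_mem' := ⟨0, 0, 0, by ext <;> simp [one_def]⟩
  inv_mem' := by
    rintro _ ⟨m, n, k, rfl⟩
    refine ⟨-m, -n, -k + 2 * (m * n), ?_⟩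
    ext <;> simp only [inv_def] <;> push_cast <;> ring

theorem isDiscrete_lattice : IsDiscrete (lattice : Set Heis) := by
  constructor
  rw [discreteTopology_iff_isOpen_singleton]
  rintro ⟨a, m, n, k, rfl⟩
  have c1 := continuous_x1
  have c2 := continuous_x2
  have c3 := continuous_y
  have hU : IsOpen {g : Heis | |g.x1 - m| < 1 ∧ |g.x2 - n| < 1 ∧ |g.y - k / 2| < 1 / 2} := by
    have o1 : IsOpen {g : Heis | |g.x1 - m| < 1} := isOpen_lt (by fun_prop) (by fun_prop)
    have o2 : IsOpen {g : Heis | |g.x2 - n| < 1} := isOpen_lt (by fun_prop) (by fun_prop)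
    have o3 : IsOpen {g : Heis | |g.y - k / 2| < 1 / 2} := isOpen_lt (by fun_prop) (by fun_prop)
    exact o1.inter (o2.inter o3)
  refine isOpen_induced_iff.2 ⟨_, hU, ?_⟩
  ext ⟨b, m', n', k', rfl⟩
  simp only [Set.mem_preimage, Set.mem_singleton_iff, Set.mem_ofPred_eq]
  constructor
  · rintro ⟨h1, h2, h3⟩
    have e1 : m' = m := by
      have : |m' - m| < 1 := by exact_mod_cast h1
      rw [Int.abs_lt_one_iff] at this; omega
    have e2 : n' = n := by
      have : |n' - n| < 1 := by exact_mod_cast h2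
      rw [Int.abs_lt_one_iff] at this; omega
    have e3 : k' = k := by
      have h4 : |(k' : ℝ) - k| < 1 := by
        rw [abs_lt] at h3 ⊢; constructor <;> linarith [h3.1, h3.2]
      have : |k' - k| < 1 := by exact_mod_cast h4
      rw [Int.abs_lt_one_iff] at this; omega
    rw [e1, e2, e3]
  · intro h
    have h' := congrArg Subtype.val h
    simp only [Heis.mk.injEq] at h'
    obtain ⟨e1, e2, e3⟩ := h'
    rw [e1, e2, e3]
    simp

/-- The matrix `B = !![2, 1; 1, 1]`, acting on `ℝ²`. -/
def matB (x : ℝ × ℝ) : ℝ × ℝ := (2 * x.1 + x.2, x.1 + x.2)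

/-- The automorphism `Φ(x, y) = (B x, y + x1² + ½ x2² + x1 x2)`. -/
def autPhi : Heis ≃* Heis where
  toFun g := ⟨(matB (g.x1, g.x2)).1, (matB (g.x1, g.x2)).2,
    g.y + g.x1 ^ 2 + 1 / 2 * g.x2 ^ 2 + g.x1 * g.x2⟩
  invFun g := ⟨g.x1 - g.x2, 2 * g.x2 - g.x1,
    g.y - ((g.x1 - g.x2) ^ 2 + 1 / 2 * (2 * g.x2 - g.x1) ^ 2
      + (g.x1 - g.x2) * (2 * g.x2 - g.x1))⟩
  left_inv g := by ext <;> simp only [matB] <;> ring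
  right_inv g := by ext <;> simp only [matB] <;> ring
  map_mul' g h := by ext <;> simp only [matB, mul_def] <;> ring

theorem autPhi_apply (g : Heis) : autPhi g =
    ⟨2 * g.x1 + g.x2, g.x1 + g.x2, g.y + g.x1 ^ 2 + 1 / 2 * g.x2 ^ 2 + g.x1 * g.x2⟩ := rfl

theorem autPhi_symm_apply (g : Heis) : autPhi.symm g = ⟨g.x1 - g.x2, 2 * g.x2 - g.x1,
    g.y - ((g.x1 - g.x2) ^ 2 + 1 / 2 * (2 * g.x2 - g.x1) ^ 2
      + (g.x1 - g.x2) * (2 * g.x2 - g.x1))⟩ := rfl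

theorem autPhi_mem {g : Heis} (hg : g ∈ lattice) : autPhi g ∈ lattice := by
  obtain ⟨m, n, k, rfl⟩ := hg
  refine ⟨2 * m + n, m + n, k + 2 * m ^ 2 + n ^ 2 + 2 * (m * n), ?_⟩
  ext <;> simp only [autPhi_apply] <;> push_cast <;> ring

theorem autPhi_symm_mem {g : Heis} (hg : g ∈ lattice) : autPhi.symm g ∈ lattice := by
  obtain ⟨m, n, k, rfl⟩ := hg
  refine ⟨m - n, 2 * n - m, k - 2 * (m - n) ^ 2 - (2 * n - m) ^ 2
    - 2 * ((m - n) * (2 * n - m)), ?_⟩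
  ext <;> simp only [autPhi_symm_apply] <;> push_cast <;> ring

/-- The Heisenberg nilmanifold `N = ℋ / Γ`, whose points are the cosets `gΓ`. -/
def Nilmanifold : Type := Heis ⧸ lattice

instance : TopologicalSpace Nilmanifold := inferInstanceAs (TopologicalSpace (Heis ⧸ lattice))

instance : MeasurableSpace Nilmanifold := borel Nilmanifold

instance : BorelSpace Nilmanifold := ⟨rfl⟩

/-- The quotient map from the Heisenberg group. -/
def toNil (g : Heis) : Nilmanifold := QuotientGroup.mk (s := lattice) g

/-- The projection `π : ℋ → N`, in the coordinates of `ℋ`. -/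
def proj (h : R3) : Nilmanifold := toNil (coords.symm h)

/-- Right multiplication `h ↦ h * g`, in the coordinates of `ℋ`. -/
def rightMul (g : Heis) (h : R3) : R3 := (h.1 + g.x1, h.2.1 + g.x2, h.2.2 + g.y + h.1 * g.x2)

theorem toNil_eq_iff {a b : Heis} : toNil a = toNil b ↔ a⁻¹ * b ∈ lattice := QuotientGroup.eq

theorem toNil_surjective : Function.Surjective toNil := QuotientGroup.mk_surjective

theorem coords_symm_rightMul (g : Heis) (h : R3) :
    coords.symm (rightMul g h) = coords.symm h * g := rfl

theorem proj_eq_iff {h h' : R3} :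
    proj h = proj h' ↔ ∃ g : Heis, g ∈ lattice ∧ h' = rightMul g h := by
  unfold proj
  rw [toNil_eq_iff]
  constructor
  · intro hm
    refine ⟨_, hm, coords.symm.injective ?_⟩
    rw [coords_symm_rightMul, mul_inv_cancel_left]
  · rintro ⟨g, hg, rfl⟩
    rwa [coords_symm_rightMul, inv_mul_cancel_left]

theorem proj_rightMul {g : Heis} (hg : g ∈ lattice) (h : R3) : proj (rightMul g h) = proj h :=
  (proj_eq_iff.2 ⟨g, hg, rfl⟩).symm

theorem proj_surjective : Function.Surjective proj :=
  toNil_surjective.comp coords.symm.surjective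

theorem isLocalHomeomorph_proj : IsLocalHomeomorph proj :=
  (lattice.isQuotientCoveringMap isDiscrete_lattice).isCoveringMap.isLocalHomeomorph.comp
    coordsHomeo.symm.isLocalHomeomorph

/-- The smooth structure of `N`: the charts are local inverses of `π`. -/
instance : ChartedSpace R3 Nilmanifold := isLocalHomeomorph_proj.chartedSpace proj_surjective

theorem atlas_symm {e : OpenPartialHomeomorph Nilmanifold R3} (he : e ∈ atlas R3 Nilmanifold) :
    ⇑e.symm = proj := by
  obtain ⟨q, rfl⟩ := he
  ext x
  simp [chartAt_self_eq]

theorem contDiff_rightMul (g : Heis) : ContDiff ℝ ∞ (rightMul g) := by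
  unfold rightMul; fun_prop

theorem atlas_comp_proj {e : OpenPartialHomeomorph Nilmanifold R3}
    (he : e ∈ atlas R3 Nilmanifold) {x : R3} (hx : proj x ∈ e.source) :
    ∃ g : Heis, g ∈ lattice ∧ e (proj x) = rightMul g x ∧
      ∀ᶠ x' in 𝓝 x, e (proj x') = rightMul g x' := by
  have hs := atlas_symm he
  have h1 : proj (e (proj x)) = proj x := by
    have h0 := e.left_inv hx
    rwa [hs] at h0
  obtain ⟨g, hg, hgx⟩ := proj_eq_iff.1 h1.symm
  refine ⟨g, hg, hgx, ?_⟩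
  have hc : ContinuousAt (rightMul g) x := (contDiff_rightMul g).continuous.continuousAt
  have ht : e.target ∈ 𝓝 (rightMul g x) := by
    rw [← hgx]; exact e.open_target.mem_nhds (e.map_source hx)
  filter_upwards [hc.preimage_mem_nhds ht] with x' hx'
  have h0 := e.right_inv hx'
  rwa [hs, proj_rightMul hg] at h0

instance : IsManifold 𝓘(ℝ, R3) ∞ Nilmanifold := by
  apply isManifold_of_contDiffOn
  intro e e' he he' x hx
  have hs := atlas_symm he
  simp only [modelWithCornersSelf_coe, modelWithCornersSelf_coe_symm, Set.preimage_id_eq, id_eq,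
    Set.range_id, Set.inter_univ, Function.id_comp, Function.comp_id,
    OpenPartialHomeomorph.coe_trans] at hx ⊢
  have hx' : proj x ∈ e'.source := by rw [← hs]; exact hx.2
  obtain ⟨g, -, -, hg⟩ := atlas_comp_proj he' hx'
  rw [hs]
  exact ((contDiff_rightMul g).contDiffAt.congr_of_eventuallyEq hg).contDiffWithinAt

theorem contMDiff_proj : ContMDiff 𝓘(ℝ, R3) 𝓘(ℝ, R3) ∞ proj := by
  intro x
  let e := chartAt R3 (proj x)
  have he : e ∈ atlas R3 Nilmanifold := chart_mem_atlas _ _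
  have hx : proj x ∈ e.source := mem_chart_source _ _
  obtain ⟨g, hg, hgx, -⟩ := atlas_comp_proj he hx
  have hfun : proj = e.symm ∘ rightMul g := by
    rw [atlas_symm he]; funext x'; exact (proj_rightMul hg x').symm
  rw [hfun]
  refine ContMDiffAt.comp x ?_ (contDiff_rightMul g).contMDiff.contMDiffAt
  rw [← hgx]
  exact (contMDiffOn_chart_symm (x := proj x)).contMDiffAt
    (e.open_target.mem_nhds (e.map_source hx))


/-- The bijection of `N` induced by `Φ`, well defined because `Φ(Γ) = Γ`. -/
def nilEquiv : Nilmanifold ≃ Nilmanifold where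
  toFun := Quotient.map' autPhi fun a b hab => by
    rw [QuotientGroup.leftRel_apply] at hab ⊢
    simpa using autPhi_mem hab
  invFun := Quotient.map' autPhi.symm fun a b hab => by
    rw [QuotientGroup.leftRel_apply] at hab ⊢
    simpa using autPhi_symm_mem hab
  left_inv p := by
    obtain ⟨g, rfl⟩ := toNil_surjective p
    change toNil (autPhi.symm (autPhi g)) = toNil g
    rw [MulEquiv.symm_apply_apply]
  right_inv p := by
    obtain ⟨g, rfl⟩ := toNil_surjective p
    change toNil (autPhi (autPhi.symm g)) = toNil g
    rw [MulEquiv.apply_symm_apply]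

theorem nilEquiv_toNil (g : Heis) : nilEquiv (toNil g) = toNil (autPhi g) := rfl

theorem nilEquiv_symm_toNil (g : Heis) : nilEquiv.symm (toNil g) = toNil (autPhi.symm g) := rfl

/-- A map out of `N` is smooth as soon as its lift to `ℋ` is. -/
theorem contMDiff_of_comp_proj {F : Nilmanifold → Nilmanifold}
    (hF : ContMDiff 𝓘(ℝ, R3) 𝓘(ℝ, R3) ∞ (F ∘ proj)) :
    ContMDiff 𝓘(ℝ, R3) 𝓘(ℝ, R3) ∞ F := by
  intro p
  have he : chartAt R3 p ∈ atlas R3 Nilmanifold := chart_mem_atlas _ _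
  have h1 : ContMDiffAt 𝓘(ℝ, R3) 𝓘(ℝ, R3) ∞ (chartAt R3 p) p :=
    contMDiffOn_chart.contMDiffAt ((chartAt R3 p).open_source.mem_nhds (mem_chart_source _ _))
  refine (ContMDiffAt.comp p (hF _) h1).congr_of_eventuallyEq ?_
  filter_upwards [(chartAt R3 p).open_source.mem_nhds (mem_chart_source R3 p)] with q hq
  have h0 := (chartAt R3 p).left_inv hq
  rw [atlas_symm he] at h0
  simp only [Function.comp_apply, h0]

/-- The diffeomorphism `f : N → N` induced by `Φ`, so that `f ∘ π = π ∘ Φ`. -/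
def nilDiffeo : Nilmanifold ≃ₘ^∞⟮𝓘(ℝ, R3), 𝓘(ℝ, R3)⟯ Nilmanifold where
  toEquiv := nilEquiv
  contMDiff_toFun := by
    apply contMDiff_of_comp_proj
    have h : ContDiff ℝ ∞ fun v : R3 => coords (autPhi (coords.symm v)) := by
      change ContDiff ℝ ∞ fun v : R3 => (2 * v.1 + v.2.1, v.1 + v.2.1,
        v.2.2 + v.1 ^ 2 + 1 / 2 * v.2.1 ^ 2 + v.1 * v.2.1)
      fun_prop
    exact contMDiff_proj.comp h.contMDiff
  contMDiff_invFun := by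
    apply contMDiff_of_comp_proj
    have h : ContDiff ℝ ∞ fun v : R3 => coords (autPhi.symm (coords.symm v)) := by
      change ContDiff ℝ ∞ fun v : R3 => (v.1 - v.2.1, 2 * v.2.1 - v.1,
        v.2.2 - ((v.1 - v.2.1) ^ 2 + 1 / 2 * (2 * v.2.1 - v.1) ^ 2
          + (v.1 - v.2.1) * (2 * v.2.1 - v.1)))
      fun_prop
    exact contMDiff_proj.comp h.contMDiff

/-- Lebesgue measure on `N`: the image of Lebesgue measure on the fundamental domain
`0 ≤ x1 < 1`, `0 ≤ x2 < 1`, `0 ≤ y < 1/2`. -/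
def lebesgueNil : Measure Nilmanifold :=
  Measure.map proj (volume.restrict
    (Set.Ico (0 : ℝ) 1 ×ˢ Set.Ico (0 : ℝ) 1 ×ˢ Set.Ico (0 : ℝ) (1 / 2)))

/-- The tangent space `T_p N`. -/
abbrev TpN (p : Nilmanifold) : Type := TangentSpace 𝓘(ℝ, R3) p

/-- The tangent bundle `TN`. -/
abbrev TN : Type := TangentBundle 𝓘(ℝ, R3) Nilmanifold

theorem mfderiv_proj_injective (h : R3) :
    Function.Injective (mfderiv 𝓘(ℝ, R3) 𝓘(ℝ, R3) proj h) := by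
  have he : chartAt R3 (proj h) ∈ atlas R3 Nilmanifold := chart_mem_atlas _ _
  obtain ⟨g, -, -, hg⟩ := atlas_comp_proj he (mem_chart_source R3 (proj h))
  have h1 : MDifferentiableAt 𝓘(ℝ, R3) 𝓘(ℝ, R3) (chartAt R3 (proj h)) (proj h) :=
    mdifferentiableAt_atlas he (mem_chart_source _ _)
  have h2 : MDifferentiableAt 𝓘(ℝ, R3) 𝓘(ℝ, R3) proj h :=
    contMDiff_proj.mdifferentiableAt (by simp)
  have h3 := mfderiv_comp h h1 h2
  have h4 : mfderiv 𝓘(ℝ, R3) 𝓘(ℝ, R3) (rightMul g⁻¹ ∘ rightMul g) h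
      = ContinuousLinearMap.id ℝ _ := by
    have : rightMul g⁻¹ ∘ rightMul g = id := by
      funext v
      apply coords.symm.injective
      simp [coords_symm_rightMul]
    rw [this, mfderiv_id]
  have h5 : ∀ a : Heis, MDifferentiable 𝓘(ℝ, R3) 𝓘(ℝ, R3) (rightMul a) := fun a =>
    (contDiff_rightMul a).contMDiff.mdifferentiable (by simp)
  rw [mfderiv_comp h (h5 _ _) (h5 _ _)] at h4
  have h6 : mfderiv 𝓘(ℝ, R3) 𝓘(ℝ, R3) (chartAt R3 (proj h) ∘ proj) h =
      mfderiv 𝓘(ℝ, R3) 𝓘(ℝ, R3) (rightMul g) h := Filter.EventuallyEq.mfderiv_eq hg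
  intro v w hvw
  have e1 : ∀ u, mfderiv 𝓘(ℝ, R3) 𝓘(ℝ, R3) (rightMul g) h u =
      mfderiv 𝓘(ℝ, R3) 𝓘(ℝ, R3) (chartAt R3 (proj h)) (proj h)
        (mfderiv 𝓘(ℝ, R3) 𝓘(ℝ, R3) proj h u) := fun u => by
    have := congrArg (fun L => L u) (h6.symm.trans h3)
    exact this
  have e2 : ∀ u, mfderiv 𝓘(ℝ, R3) 𝓘(ℝ, R3) (rightMul g⁻¹) (rightMul g h)
      (mfderiv 𝓘(ℝ, R3) 𝓘(ℝ, R3) (rightMul g) h u) = u := fun u => by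
    have := congrArg (fun L => L u) h4
    exact this
  rw [← e2 v, ← e2 w, e1, e1, hvw]

instance (p : Nilmanifold) : FiniteDimensional ℝ (TpN p) :=
  inferInstanceAs (FiniteDimensional ℝ R3)

/-- The differential `Dπ_h : T_h ℋ → T_{π h} N`, a linear isomorphism. -/
def dproj (h : R3) : R3 ≃ₗ[ℝ] TpN (proj h) :=
  LinearEquiv.ofInjectiveOfFinrankEq (mfderiv 𝓘(ℝ, R3) 𝓘(ℝ, R3) proj h).toLinearMap
    (mfderiv_proj_injective h) rfl

theorem dproj_apply (h : R3) (v : R3) :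
    dproj h v = mfderiv 𝓘(ℝ, R3) 𝓘(ℝ, R3) proj h v := rfl

/-- `Dπ_h` for a point `h` over `p`, with values in `T_p N`. -/
def dprojAt {p : Nilmanifold} (h : R3) (hp : proj h = p) : R3 ≃ₗ[ℝ] TpN p := hp ▸ dproj h

/-- A pair of eigenvectors of `B`, for the eigenvalues `(3 - √5)/2 < 1` and `(3 + √5)/2 > 1`. -/
structure Eigenvectors where
  vs : ℝ × ℝ
  vu : ℝ × ℝ
  vs_ne : vs ≠ 0
  vu_ne : vu ≠ 0
  matB_vs : matB vs = ((3 - √5) / 2) • vs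
  matB_vu : matB vu = ((3 + √5) / 2) • vu

/-- The vector field `h ↦ (v, x2 v₁)` on `ℋ`; it is invariant under right translations. -/
def field (v : ℝ × ℝ) (h : R3) : R3 := (v.1, v.2, h.2.1 * v.1)

/-- The vector field `h ↦ (0, 0, 1)` on `ℋ`; it is invariant under right translations. -/
def centralField (_h : R3) : R3 := (0, 0, 1)

theorem Eigenvectors.det_ne_zero (e : Eigenvectors) :
    e.vs.1 * e.vu.2 - e.vs.2 * e.vu.1 ≠ 0 := by
  obtain ⟨⟨p, q⟩, ⟨r, t⟩, hs, hu, h1, h2⟩ := e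
  simp only [matB, Prod.smul_mk, smul_eq_mul, Prod.mk.injEq] at h1 h2
  simp only [ne_eq, Prod.mk_eq_zero, not_and] at hs hu ⊢
  obtain ⟨h1, -⟩ := h1
  obtain ⟨h2, -⟩ := h2
  have h5 : (0 : ℝ) < √5 := by positivity
  have hq : q = (-1 - √5) / 2 * p := by linarith
  have ht : t = (-1 + √5) / 2 * r := by linarith
  have hp0 : p ≠ 0 := fun h => hs h (by rw [hq, h, mul_zero])
  have hr0 : r ≠ 0 := fun h => hu h (by rw [ht, h, mul_zero])
  have : p * t - q * r = √5 * (p * r) := by rw [hq, ht]; ring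
  rw [this]
  exact mul_ne_zero h5.ne' (mul_ne_zero hp0 hr0)

/-- The frame `(field vs, field vu, centralField)` of `ℋ` at `h`: it sends `(a, b, c)` to
`a • field vs h + b • field vu h + c • centralField h`. -/
def Eigenvectors.frameMap (e : Eigenvectors) (h : R3) : R3 →ₗ[ℝ] R3 where
  toFun w := w.1 • field e.vs h + w.2.1 • field e.vu h + w.2.2 • centralField h
  map_add' v w := by simp only [Prod.fst_add, Prod.snd_add, add_smul]; abel
  map_smul' a w := by
    simp only [Prod.smul_fst, Prod.smul_snd, smul_eq_mul, mul_smul, smul_add, RingHom.id_apply]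

theorem Eigenvectors.frameMap_injective (e : Eigenvectors) (h : R3) :
    Function.Injective (e.frameMap h) := by
  rw [injective_iff_map_eq_zero]
  rintro ⟨a, b, c⟩ hw
  have hd := e.det_ne_zero
  simp only [frameMap, field, centralField, LinearMap.coe_mk, AddHom.coe_mk, Prod.smul_mk,
    Prod.mk_add_mk, smul_eq_mul, Prod.mk_eq_zero, mul_zero, add_zero, mul_one] at hw ⊢
  obtain ⟨h1, h2, h3⟩ := hw
  have ha : a = 0 := by
    have : a * (e.vs.1 * e.vu.2 - e.vs.2 * e.vu.1) = 0 := by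
      linear_combination e.vu.2 * h1 - e.vu.1 * h2
    exact (mul_eq_zero.1 this).resolve_right hd
  have hb : b = 0 := by
    have : b * (e.vs.1 * e.vu.2 - e.vs.2 * e.vu.1) = 0 := by
      linear_combination e.vs.1 * h2 - e.vs.2 * h1
    exact (mul_eq_zero.1 this).resolve_right hd
  refine ⟨ha, hb, ?_⟩
  rw [ha, hb] at h3
  simpa using h3

/-- The frame of `ℋ` at `h`, as an isomorphism `ℝ³ → T_h ℋ`. -/
def Eigenvectors.frameH (e : Eigenvectors) (h : R3) : R3 ≃ₗ[ℝ] R3 :=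
  LinearEquiv.ofInjectiveOfFinrankEq (e.frameMap h) (e.frameMap_injective h) rfl

theorem Eigenvectors.frameH_apply (e : Eigenvectors) (h w : R3) : e.frameH h w =
    w.1 • field e.vs h + w.2.1 • field e.vu h + w.2.2 • centralField h := rfl

/-- A point of `ℋ` over `p`. -/
def rep (p : Nilmanifold) : R3 := (proj_surjective p).choose

theorem proj_rep (p : Nilmanifold) : proj (rep p) = p := (proj_surjective p).choose_spec

/-- The frame of `TN` induced by the invariant frame `(field vs, field vu, centralField)` of `ℋ`. -/
def Eigenvectors.frame (e : Eigenvectors) (p : Nilmanifold) : R3 ≃ₗ[ℝ] TpN p :=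
  e.frameH (rep p) ≪≫ₗ dprojAt (rep p) (proj_rep p)

theorem dprojAt_eq {p : Nilmanifold} (h : R3) (hp : proj h = p) (w : R3) :
    dprojAt h hp w = mfderiv 𝓘(ℝ, R3) 𝓘(ℝ, R3) proj h w := by
  subst hp; rfl

theorem mfderiv_rightMul (g : Heis) (h w : R3) :
    mfderiv 𝓘(ℝ, R3) 𝓘(ℝ, R3) (rightMul g) h w
      = ((w.1, w.2.1, w.2.2 + w.1 * g.x2) : R3) := by
  have h1 : HasFDerivAt (rightMul g)
      ((ContinuousLinearMap.fst ℝ ℝ (ℝ × ℝ)).prod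
        (((ContinuousLinearMap.fst ℝ ℝ ℝ).comp (ContinuousLinearMap.snd ℝ ℝ (ℝ × ℝ))).prod
          ((ContinuousLinearMap.snd ℝ ℝ ℝ).comp (ContinuousLinearMap.snd ℝ ℝ (ℝ × ℝ))
            + g.x2 • ContinuousLinearMap.fst ℝ ℝ (ℝ × ℝ)))) h := by
    unfold rightMul
    refine (hasFDerivAt_fst.add_const _).prodMk ((hasFDerivAt_snd.fst.add_const _).prodMk ?_)
    exact (hasFDerivAt_snd.snd.add_const _).add (hasFDerivAt_fst.mul_const _)
  have h2 : fderiv ℝ (rightMul g) h w = (w.1, w.2.1, w.2.2 + w.1 * g.x2) := by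
    rw [h1.fderiv]
    simp [mul_comm]
  rw [mfderiv_eq_fderiv]
  exact h2

theorem Eigenvectors.frameH_rightMul (e : Eigenvectors) (g : Heis) (h w : R3) :
    mfderiv 𝓘(ℝ, R3) 𝓘(ℝ, R3) (rightMul g) h (e.frameH h w) = e.frameH (rightMul g h) w := by
  rw [mfderiv_rightMul, frameH_apply, frameH_apply]
  simp only [field, centralField, rightMul, Prod.smul_mk, Prod.mk_add_mk, smul_eq_mul]
  refine Prod.ext ?_ (Prod.ext ?_ ?_) <;> dsimp only <;> ring

/-- The frame does not depend on the choice of the point over `p`. -/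
theorem Eigenvectors.frame_proj (e : Eigenvectors) (h w : R3) :
    e.frame (proj h) w = dproj h (e.frameH h w) := by
  obtain ⟨g, hg, hr⟩ := proj_eq_iff.1 (proj_rep (proj h)).symm
  have hpr : proj ∘ rightMul g = proj := funext fun v => proj_rightMul hg v
  have hmd : ∀ v, MDifferentiableAt 𝓘(ℝ, R3) 𝓘(ℝ, R3) proj v := fun v =>
    contMDiff_proj.mdifferentiableAt (by simp)
  have hmr : MDifferentiableAt 𝓘(ℝ, R3) 𝓘(ℝ, R3) (rightMul g) h :=
    (contDiff_rightMul g).contMDiff.mdifferentiableAt (by simp)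
  have hc := mfderiv_comp h (hmd _) hmr
  change dprojAt (rep (proj h)) (proj_rep (proj h)) (e.frameH (rep (proj h)) w) = _
  rw [dprojAt_eq, hr, ← frameH_rightMul, dproj_apply]
  have h2 := congrArg (fun L => L (e.frameH h w)) hc
  have h3 : (mfderiv 𝓘(ℝ, R3) 𝓘(ℝ, R3) (proj ∘ rightMul g) h (e.frameH h w) : R3)
      = mfderiv 𝓘(ℝ, R3) 𝓘(ℝ, R3) proj h (e.frameH h w) := by rw [hpr]
  exact h2.symm.trans h3

/-- The stable line bundle `E^s` of `f`. -/
def Eigenvectors.stable (e : Eigenvectors) (p : Nilmanifold) : Submodule ℝ (TpN p) :=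
  Submodule.span ℝ {e.frame p (1, 0, 0)}

/-- The center-unstable plane bundle `E^cu` of `f`, with its global frame
`(e.frame p (0, 1, 0), e.frame p (0, 0, 1))`. -/
def Eigenvectors.centerUnstable (e : Eigenvectors) (p : Nilmanifold) : Submodule ℝ (TpN p) :=
  Submodule.span ℝ {e.frame p (0, 1, 0), e.frame p (0, 0, 1)}

/-- The rotation by `θ` of the last two coordinates of `ℝ³`. -/
def rot (θ : ℝ) : R3 →ₗ[ℝ] R3 where
  toFun w := (w.1, Real.cos θ * w.2.1 - Real.sin θ * w.2.2,
    Real.sin θ * w.2.1 + Real.cos θ * w.2.2)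
  map_add' v w := by ext <;> simp <;> ring
  map_smul' a w := by ext <;> simp <;> ring

/-- The map `F_θ : T_p N → T_{f p} N`. It is `v ↦ Df (R_θ v)` on `E^cu`, where `R_θ` is the rotation
by `θ` in the global frame of `E^cu`, and `v ↦ Df v` on `E^s`. -/
def Eigenvectors.rotatedDeriv (e : Eigenvectors) (θ : ℝ) (p : Nilmanifold) :
    TpN p →ₗ[ℝ] TpN (nilDiffeo p) :=
  (mfderiv 𝓘(ℝ, R3) 𝓘(ℝ, R3) nilDiffeo p).toLinearMap ∘ₗ
    (e.frame p).toLinearMap ∘ₗ rot θ ∘ₗ (e.frame p).symm.toLinearMap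

/-- The map of the tangent bundle given by linear maps `T_p N → T_{f p} N`. -/
def total {f : Nilmanifold → Nilmanifold} (L : ∀ p, TpN p →ₗ[ℝ] TpN (f p)) : TN → TN :=
  fun ξ => ⟨f ξ.1, L ξ.1 ξ.2⟩

/-- A continuous Riemannian metric on `N`. -/
abbrev Metric : Type := Bundle.ContinuousRiemannianMetric R3 TpN

/-- The norm of a tangent vector. -/
def Metric.nrm (g : Metric) (ξ : TN) : ℝ := √(g.inner ξ.1 ξ.2 ξ.2)

/-- A continuous linear cocycle over `f`: a continuous map of `TN` that restricts to a linear
isomorphism `T_p N → T_{f p} N` for each `p`. -/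
structure IsLinearCocycle {f : Nilmanifold → Nilmanifold}
    (L : ∀ p, TpN p →ₗ[ℝ] TpN (f p)) : Prop where
  continuous : Continuous (total L)
  bijective : ∀ p, Function.Bijective (L p)

/-- A continuous line subbundle of `TN`: locally it is spanned by a continuous nonvanishing
section. -/
def IsContinuousLineBundle (E : ∀ p : Nilmanifold, Submodule ℝ (TpN p)) : Prop :=
  ∀ p, ∃ s : ∀ q : Nilmanifold, TpN q, ∃ U ∈ 𝓝 p,
    ContinuousOn (fun q => (⟨q, s q⟩ : TN)) U ∧
    ∀ q ∈ U, s q ≠ 0 ∧ E q = Submodule.span ℝ {s q}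

/-- The cocycle `F = total L` over `f` is partially hyperbolic with the splitting
`TN = Es ⊕ Ec ⊕ Eu` into continuous invariant line bundles: `Es` is uniformly contracted, `Eu` is
uniformly expanded, and the splittings `Es ⊕ Ec` and `Ec ⊕ Eu` are dominated. -/
structure IsPartiallyHyperbolic (g : Metric) {f : Nilmanifold → Nilmanifold}
    (L : ∀ p, TpN p →ₗ[ℝ] TpN (f p)) (Es Ec Eu : ∀ p : Nilmanifold, Submodule ℝ (TpN p)) :
    Prop where
  cocycle : IsLinearCocycle L
  continuous_s : IsContinuousLineBundle Es
  continuous_c : IsContinuousLineBundle Ec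
  continuous_u : IsContinuousLineBundle Eu
  splitting : ∀ p, DirectSum.IsInternal ![Es p, Ec p, Eu p]
  invariant_s : ∀ p, (Es p).map (L p) = Es (f p)
  invariant_c : ∀ p, (Ec p).map (L p) = Ec (f p)
  invariant_u : ∀ p, (Eu p).map (L p) = Eu (f p)
  estimates : ∃ C ρ : ℝ, 0 < C ∧ 0 < ρ ∧ ρ < 1 ∧ ∀ (p : Nilmanifold) (n : ℕ),
    (∀ v ∈ Es p, g.nrm ((total L)^[n] ⟨p, v⟩) ≤ C * ρ ^ n * g.nrm ⟨p, v⟩) ∧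
    (∀ v ∈ Eu p, g.nrm ⟨p, v⟩ ≤ C * ρ ^ n * g.nrm ((total L)^[n] ⟨p, v⟩)) ∧
    (∀ v ∈ Es p, ∀ w ∈ Ec p, g.nrm ((total L)^[n] ⟨p, v⟩) * g.nrm ⟨p, w⟩ ≤
      C * ρ ^ n * (g.nrm ((total L)^[n] ⟨p, w⟩) * g.nrm ⟨p, v⟩)) ∧
    (∀ v ∈ Ec p, ∀ w ∈ Eu p, g.nrm ((total L)^[n] ⟨p, v⟩) * g.nrm ⟨p, w⟩ ≤
      C * ρ ^ n * (g.nrm ((total L)^[n] ⟨p, w⟩) * g.nrm ⟨p, v⟩))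

/-- The Lyapunov exponent of `F` along `ξ` exists and equals `l`:
`(1/n) log ‖F^n ξ‖ → l` as `n → ∞`. -/
def HasLyapunovExponent (g : Metric) (F : TN → TN) (ξ : TN) (l : ℝ) : Prop :=
  Tendsto (fun n : ℕ => 1 / (n : ℝ) * Real.log (g.nrm (F^[n] ξ))) atTop (𝓝 l)

/-- Nonuniform hyperbolicity: at almost every point, every nonzero vector has a nonzero Lyapunov
exponent. -/
def IsNonuniformlyHyperbolic (g : Metric) (μ : Measure Nilmanifold) (F : TN → TN) : Prop :=
  ∀ᵐ p ∂μ, ∀ v : TpN p, v ≠ 0 → ∃ l : ℝ, l ≠ 0 ∧ HasLyapunovExponent g F ⟨p, v⟩ l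

end HeisNil

end

/-!
In the invariant frame `(X_s, X_u, X_c)` the differential of `f` has the constant matrix
`diag(λ⁻¹, λ, 1)` with `λ = (3 + √5)/2` (`Eigenvectors.mfderiv_nilDiffeo_frame`), because `Φ` is an
automorphism and maps the invariant fields to multiples of themselves. The rotation `R_θ` has a
constant matrix in the same frame, so `F_θ` is a constant linear map read in a global frame.

On `E^cu` that matrix has determinant `λ` and trace `(λ + 1) cos θ`. At `θ = 0` its eigenvalues are
`1` and `λ`. Its characteristic polynomial takes the value `(λ + 1)(1 - cos θ) > 0` at `1` once
`θ ≠ 0`, so for small `θ > 0` both roots `μ < ν` exceed `1`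
(`exists_centerUnstable_eigenvalues`, for `0 < θ < 2/5`). The bundles `E^c_θ` and `E^u_θ` are spanned
by the fields whose constant coordinates are eigenvectors for `μ` and `ν`, and `λ^c_θ = log μ`.

Changing the frame by a constant matrix, `F_θ` becomes `diag(λ⁻¹, μ, ν)`
(`Eigenvectors.isDiagonalIn_rotatedDeriv`). Since `N` is compact, every continuous Riemannian metric
is uniformly comparable with the norm of the coordinates in the new frame
(`IsDiagonalIn.exists_nrm_bounds`), so partial hyperbolicity and the exponents, at every point of
`N`, follow from `λ⁻¹ < 1 < μ < ν` by computing with a diagonal matrix.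
-/

noncomputable section

namespace HeisNil

/-! ### The invariant frame as a global trivialization of the tangent bundle -/

theorem isOpenQuotientMap_proj : IsOpenQuotientMap proj :=
  ⟨proj_surjective, isLocalHomeomorph_proj.continuous, isLocalHomeomorph_proj.isOpenMap⟩

/-- `N` is the image of the unit cube. -/
instance : CompactSpace Nilmanifold := by
  have hK : IsCompact (Set.Icc (0 : ℝ) 1 ×ˢ Set.Icc (0 : ℝ) 1 ×ˢ Set.Icc (0 : ℝ) 1) :=
    isCompact_Icc.prod (isCompact_Icc.prod isCompact_Icc)
  refine ⟨(hK.image isOpenQuotientMap_proj.continuous).of_isClosed_subset isClosed_univ ?_⟩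
  intro p _
  obtain ⟨⟨x, z, y⟩, rfl⟩ := proj_surjective p
  -- Right multiplication by `(-⌊x⌋, -⌊z⌋, ·)` changes the last coordinate by `-x * ⌊z⌋`.
  refine ⟨(Int.fract x, Int.fract z, Int.fract (y - x * ⌊z⌋)), ?_, ?_⟩
  · exact ⟨⟨Int.fract_nonneg _, (Int.fract_lt_one _).le⟩,
      ⟨Int.fract_nonneg _, (Int.fract_lt_one _).le⟩,
      ⟨Int.fract_nonneg _, (Int.fract_lt_one _).le⟩⟩
  · refine (proj_eq_iff.2 ⟨⟨-⌊x⌋, -⌊z⌋, -⌊y - x * ⌊z⌋⌋⟩, ?_, ?_⟩).symm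
    · exact ⟨-⌊x⌋, -⌊z⌋, -2 * ⌊y - x * ⌊z⌋⌋, by ext <;> push_cast <;> ring⟩
    · simp only [rightMul, Int.fract, Prod.mk.injEq]
      refine ⟨?_, ?_, ?_⟩ <;> ring

theorem Eigenvectors.frameH_symm_apply (e : Eigenvectors) (h v : R3) :
    (e.frameH h).symm v =
      ((v.1 * e.vu.2 - v.2.1 * e.vu.1) / (e.vs.1 * e.vu.2 - e.vs.2 * e.vu.1),
        (e.vs.1 * v.2.1 - e.vs.2 * v.1) / (e.vs.1 * e.vu.2 - e.vs.2 * e.vu.1),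
        v.2.2 - h.2.1 * v.1) := by
  have hd := e.det_ne_zero
  rw [LinearEquiv.symm_apply_eq, frameH_apply]
  simp only [field, centralField, Prod.smul_mk, Prod.mk_add_mk, smul_eq_mul]
  generalize hD : e.vs.1 * e.vu.2 - e.vs.2 * e.vu.1 = d at hd ⊢
  refine Prod.ext ?_ (Prod.ext ?_ ?_) <;> dsimp only <;> field_simp <;> rw [← hD] <;> ring

/-- The frame trivializes `TN` continuously. -/
theorem Eigenvectors.continuous_frame (e : Eigenvectors) :
    Continuous fun q : Nilmanifold × R3 => (⟨q.1, e.frame q.1 q.2⟩ : TN) := by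
  -- Continuity can be tested after composition with the quotient map `π × id`.
  have hq := isOpenQuotientMap_proj.prodMap (IsOpenQuotientMap.id (X := R3))
  rw [hq.isQuotientMap.continuous_iff]
  have h1 : Continuous fun q : R3 × R3 => (q.1, e.frameH q.1 q.2) := by
    simp only [frameH_apply, field, centralField]
    fun_prop
  have h2 := (contMDiff_proj.continuous_tangentMap (by simp)).comp
    ((tangentBundleModelSpaceHomeomorph 𝓘(ℝ, R3)).symm.continuous.comp h1)
  refine h2.congr fun q => ?_
  change (⟨proj q.1, dproj q.1 (e.frameH q.1 q.2)⟩ : TN) = ⟨proj q.1, e.frame (proj q.1) q.2⟩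
  rw [e.frame_proj]

/-- The charts of `N` are local inverses of `π`, so they carry the frame of `TN` back to the
frame of `ℋ`. -/
theorem Eigenvectors.mfderiv_chart_frame (e : Eigenvectors) (p : Nilmanifold) {q : Nilmanifold}
    (hq : q ∈ (chartAt R3 p).source) (w : R3) :
    mfderiv 𝓘(ℝ, R3) 𝓘(ℝ, R3) (chartAt R3 p) q (e.frame q w)
      = e.frameH (chartAt R3 p q) w := by
  have he : chartAt R3 p ∈ atlas R3 Nilmanifold := chart_mem_atlas _ _
  obtain ⟨h, hh, rfl⟩ : ∃ h ∈ (chartAt R3 p).target, proj h = q := by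
    refine ⟨chartAt R3 p q, (chartAt R3 p).map_source hq, ?_⟩
    rw [← atlas_symm he]
    exact (chartAt R3 p).left_inv hq
  have hid : chartAt R3 p ∘ proj =ᶠ[𝓝 h] id := by
    filter_upwards [(chartAt R3 p).open_target.mem_nhds hh] with x hx
    have h0 := (chartAt R3 p).right_inv hx
    rwa [atlas_symm he] at h0
  have h1 : MDifferentiableAt 𝓘(ℝ, R3) 𝓘(ℝ, R3) (chartAt R3 p) (proj h) :=
    mdifferentiableAt_atlas he hq
  have h2 : MDifferentiableAt 𝓘(ℝ, R3) 𝓘(ℝ, R3) proj h :=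
    contMDiff_proj.mdifferentiableAt (by simp)
  have h3 := mfderiv_comp h h1 h2
  have h4 : mfderiv 𝓘(ℝ, R3) 𝓘(ℝ, R3) (chartAt R3 p ∘ proj) h =
      mfderiv 𝓘(ℝ, R3) 𝓘(ℝ, R3) (id : R3 → R3) h := hid.mfderiv_eq
  rw [mfderiv_id] at h4
  have h5 := congrArg (fun L => L (e.frameH h w)) (h3.symm.trans h4)
  have h6 : chartAt R3 p (proj h) = h := hid.eq_of_nhds
  rw [e.frame_proj, h6]
  exact h5

/-- The coordinates of a tangent vector in the frame depend continuously on the vector. -/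
theorem Eigenvectors.continuous_frame_symm (e : Eigenvectors) :
    Continuous fun ξ : TN => (e.frame ξ.1).symm ξ.2 := by
  rw [continuous_iff_continuousAt]
  rintro ⟨p, v⟩
  -- Near `p` the coordinates are those of the image vector under the tangent map of a chart.
  have hs := (chartAt R3 p).open_source
  have h1 : ContMDiffOn 𝓘(ℝ, R3) 𝓘(ℝ, R3) ∞ (chartAt R3 p) (chartAt R3 p).source :=
    contMDiffOn_chart
  have h2 := h1.continuousOn_tangentMapWithin (by simp) hs.uniqueMDiffOn
  have hn : (Bundle.TotalSpace.proj ⁻¹' (chartAt R3 p).source : Set TN) ∈ 𝓝 (⟨p, v⟩ : TN) :=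
    (hs.preimage (FiberBundle.continuous_proj R3 (TangentSpace 𝓘(ℝ, R3)))).mem_nhds
      (mem_chart_source R3 p)
  have h3 := (tangentBundleModelSpaceHomeomorph 𝓘(ℝ, R3)).continuous.continuousAt.comp
    (h2.continuousAt hn)
  have h4 : Continuous fun q : R3 × R3 => (e.frameH q.1).symm q.2 := by
    simp only [frameH_symm_apply]
    fun_prop
  refine (h4.continuousAt.comp h3).congr ?_
  filter_upwards [hn] with ξ hξ
  have h5 : mfderivWithin 𝓘(ℝ, R3) 𝓘(ℝ, R3) (chartAt R3 p) (chartAt R3 p).source ξ.1 =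
      mfderiv 𝓘(ℝ, R3) 𝓘(ℝ, R3) (chartAt R3 p) ξ.1 := mfderivWithin_of_isOpen hs hξ
  change (e.frameH (chartAt R3 p ξ.1)).symm
    (mfderivWithin 𝓘(ℝ, R3) 𝓘(ℝ, R3) (chartAt R3 p) (chartAt R3 p).source ξ.1 ξ.2) = _
  rw [h5]
  refine (LinearEquiv.symm_apply_eq _).2 ?_
  rw [← e.mfderiv_chart_frame p hξ, LinearEquiv.apply_symm_apply]

/-! ### The differential of `f` in the invariant frame -/

/-- In the frame, the differential of `f` is the constant diagonal matrix of the eigenvalues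
`(3 - √5)/2`, `(3 + √5)/2` and `1`. -/
theorem Eigenvectors.mfderiv_nilDiffeo_frame (e : Eigenvectors) (p : Nilmanifold) (w : R3) :
    mfderiv 𝓘(ℝ, R3) 𝓘(ℝ, R3) nilDiffeo p (e.frame p w) =
      e.frame (nilDiffeo p) ((3 - √5) / 2 * w.1, (3 + √5) / 2 * w.2.1, w.2.2) := by
  obtain ⟨h, rfl⟩ := proj_surjective p
  have hlift : nilDiffeo ∘ proj = proj ∘ fun v : R3 => ((2 * v.1 + v.2.1, v.1 + v.2.1,
      v.2.2 + v.1 ^ 2 + 1 / 2 * v.2.1 ^ 2 + v.1 * v.2.1) : R3) := rfl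
  set Φ : R3 → R3 := fun v : R3 => ((2 * v.1 + v.2.1, v.1 + v.2.1,
      v.2.2 + v.1 ^ 2 + 1 / 2 * v.2.1 ^ 2 + v.1 * v.2.1) : R3) with hΦ
  have hmd : ∀ v, MDifferentiableAt 𝓘(ℝ, R3) 𝓘(ℝ, R3) proj v := fun v =>
    contMDiff_proj.mdifferentiableAt (by simp)
  have hmf : MDifferentiableAt 𝓘(ℝ, R3) 𝓘(ℝ, R3) nilDiffeo (proj h) :=
    nilDiffeo.contMDiff_toFun.mdifferentiableAt (by simp)
  have hΦd : DifferentiableAt ℝ Φ h := by rw [hΦ]; fun_prop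
  have hderiv : ∀ u : R3, fderiv ℝ Φ h u = (2 * u.1 + u.2.1, u.1 + u.2.1,
      u.2.2 + 2 * h.1 * u.1 + h.2.1 * u.2.1 + (h.1 * u.2.1 + h.2.1 * u.1)) := by
    intro u
    have hl : HasLineDerivAt ℝ Φ (2 * u.1 + u.2.1, u.1 + u.2.1,
      u.2.2 + 2 * h.1 * u.1 + h.2.1 * u.2.1 + (h.1 * u.2.1 + h.2.1 * u.1)) h u := by
      have a1 : HasDerivAt (fun t : ℝ => (h + t • u).1) u.1 0 := by
        simpa using ((hasDerivAt_id (0 : ℝ)).mul_const u.1).const_add h.1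
      have a2 : HasDerivAt (fun t : ℝ => (h + t • u).2.1) u.2.1 0 := by
        simpa using ((hasDerivAt_id (0 : ℝ)).mul_const u.2.1).const_add h.2.1
      have a3 : HasDerivAt (fun t : ℝ => (h + t • u).2.2) u.2.2 0 := by
        simpa using ((hasDerivAt_id (0 : ℝ)).mul_const u.2.2).const_add h.2.2
      have b1 := (a1.const_mul 2).add a2
      have b2 := a1.add a2
      have b3 := ((a3.add (a1.pow 2)).add ((a2.pow 2).const_mul (1 / 2))).add (a1.mul a2)
      refine (b1.prodMk (b2.prodMk b3)).congr_deriv ?_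
      refine Prod.ext rfl (Prod.ext rfl ?_)
      simp
      ring
    rw [← hΦd.lineDeriv_eq_fderiv, hl.lineDeriv]
  have hdf : mfderiv 𝓘(ℝ, R3) 𝓘(ℝ, R3) Φ h (e.frameH h w) =
      e.frameH (Φ h) ((3 - √5) / 2 * w.1, (3 + √5) / 2 * w.2.1, w.2.2) := by
    rw [mfderiv_eq_fderiv]
    refine (hderiv _).trans ?_
    have hs := e.matB_vs
    have hu := e.matB_vu
    simp only [matB, Prod.ext_iff, Prod.smul_fst, Prod.smul_snd, smul_eq_mul] at hs hu
    obtain ⟨hs1, hs2⟩ := hs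
    obtain ⟨hu1, hu2⟩ := hu
    simp only [frameH_apply, field, centralField, Prod.smul_mk, Prod.mk_add_mk, smul_eq_mul, hΦ]
    refine Prod.ext ?_ (Prod.ext ?_ ?_) <;> dsimp only
    · linear_combination w.1 * hs1 + w.2.1 * hu1
    · linear_combination w.1 * hs2 + w.2.1 * hu2
    · linear_combination (h.1 + h.2.1) * (w.1 * hs1 + w.2.1 * hu1)
  have hc1 := mfderiv_comp h hmf (hmd h)
  have hc2 := mfderiv_comp h (hmd (Φ h)) hΦd.mdifferentiableAt
  have e1 : mfderiv 𝓘(ℝ, R3) 𝓘(ℝ, R3) (nilDiffeo ∘ proj) h (e.frameH h w) =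
      mfderiv 𝓘(ℝ, R3) 𝓘(ℝ, R3) nilDiffeo (proj h) (e.frame (proj h) w) := by
    rw [e.frame_proj]
    exact congrArg (fun L => L (e.frameH h w)) hc1
  have e2 : mfderiv 𝓘(ℝ, R3) 𝓘(ℝ, R3) (proj ∘ Φ) h (e.frameH h w) =
      e.frame (proj (Φ h)) ((3 - √5) / 2 * w.1, (3 + √5) / 2 * w.2.1, w.2.2) := by
    rw [e.frame_proj, ← hdf]
    exact congrArg (fun L => L (e.frameH h w)) hc2
  exact e1.symm.trans e2

/-! ### The norm of a Riemannian metric -/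

theorem Metric.nrm_smul (g : Metric) (p : Nilmanifold) (t : ℝ) (v : TpN p) :
    g.nrm ⟨p, t • v⟩ = |t| * g.nrm ⟨p, v⟩ := by
  change √(g.inner p (t • v) (t • v)) = |t| * √(g.inner p v v)
  rw [map_smul, map_smul, smul_apply, smul_eq_mul, smul_eq_mul, ← mul_assoc,
    Real.sqrt_mul (mul_self_nonneg t), Real.sqrt_mul_self_eq_abs]

theorem Metric.nrm_pos (g : Metric) (p : Nilmanifold) {v : TpN p} (hv : v ≠ 0) :
    0 < g.nrm ⟨p, v⟩ := Real.sqrt_pos.2 (g.pos p v hv)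

theorem Metric.nrm_nonneg (g : Metric) (ξ : TN) : 0 ≤ g.nrm ξ := Real.sqrt_nonneg _

theorem Metric.continuous_nrm (g : Metric) : Continuous g.nrm := by
  have h1 : Continuous fun ξ : TN => (⟨ξ.1, g.inner ξ.1 ξ.2 ξ.2⟩ :
      Bundle.TotalSpace ℝ (Bundle.Trivial Nilmanifold ℝ)) :=
    (g.continuous.comp (FiberBundle.continuous_proj R3 TpN)).clm_bundle_apply₂
      continuous_id continuous_id
  have h2 := (Bundle.Trivial.homeomorphProd Nilmanifold ℝ).continuous.comp h1
  exact (continuous_snd.comp h2).sqrt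

/-! ### Cocycles with a constant diagonal matrix in a global frame -/

/-- The diagonal matrix with entries `a`, `b`, `c`. -/
def diag (a b c : ℝ) (w : R3) : R3 := (a * w.1, b * w.2.1, c * w.2.2)

/-- The linear maps `L p : T_p N → T_{f p} N` have the constant diagonal matrix with entries
`a`, `b`, `c` in the continuous global frame `G` of `TN`. The frame is encoded by the isomorphisms
`ℝ³ → T_p N` that it defines. -/
structure IsDiagonalIn {f : Nilmanifold → Nilmanifold} (L : ∀ p, TpN p →ₗ[ℝ] TpN (f p))
    (G : ∀ p, R3 ≃ₗ[ℝ] TpN p) (a b c : ℝ) : Prop where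
  continuous_base : Continuous f
  continuous_frame : Continuous fun q : Nilmanifold × R3 => (⟨q.1, G q.1 q.2⟩ : TN)
  continuous_symm : Continuous fun ξ : TN => (G ξ.1).symm ξ.2
  apply_frame : ∀ p w, L p (G p w) = G (f p) (diag a b c w)

/-- The line bundle spanned by the vector field with constant coordinates `w` in the frame `G`. -/
def frameLine (G : ∀ p, R3 ≃ₗ[ℝ] TpN p) (w : R3) (p : Nilmanifold) : Submodule ℝ (TpN p) :=
  Submodule.span ℝ {G p w}

theorem mem_frameLine (G : ∀ p, R3 ≃ₗ[ℝ] TpN p) {w : R3} {p : Nilmanifold}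
    {v : TpN p} : v ∈ frameLine G w p ↔ ∃ t : ℝ, G p (t • w) = v := by
  simp only [frameLine, Submodule.mem_span_singleton, map_smul]

theorem isInternal_frameLine (G : ∀ p, R3 ≃ₗ[ℝ] TpN p) (p : Nilmanifold) :
    DirectSum.IsInternal ![frameLine G (1, 0, 0) p, frameLine G (0, 1, 0) p,
      frameLine G (0, 0, 1) p] := by
  have hE : ![frameLine G (1, 0, 0) p, frameLine G (0, 1, 0) p, frameLine G (0, 0, 1) p] =
      fun i => Submodule.span ℝ {![G p (1, 0, 0), G p (0, 1, 0), G p (0, 0, 1)] i} := by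
    funext i
    fin_cases i <;> rfl
  rw [hE, DirectSum.isInternal_submodule_iff_iSupIndep_and_iSup_eq_top]
  constructor
  · refine LinearIndependent.iSupIndep_span_singleton ?_
    rw [Fintype.linearIndependent_iff]
    intro t ht
    simp only [Fin.sum_univ_three, Matrix.cons_val, ← map_smul, ← map_add] at ht
    have h0 := (G p).map_eq_zero_iff.1 ht
    simp only [Prod.smul_mk, Prod.mk_add_mk, smul_eq_mul, mul_one, mul_zero, add_zero, zero_add,
      Prod.mk_eq_zero] at h0
    intro i
    fin_cases i
    exacts [h0.1, h0.2.1, h0.2.2]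
  · rw [eq_top_iff]
    intro v _
    obtain ⟨⟨x, y, z⟩, rfl⟩ := (G p).surjective v
    have hw : ((x, y, z) : R3) = x • (1, 0, 0) + y • (0, 1, 0) + z • (0, 0, 1) := by simp
    rw [hw, map_add, map_add, map_smul, map_smul, map_smul]
    have hm : ∀ i : Fin 3, ![G p (1, 0, 0), G p (0, 1, 0), G p (0, 0, 1)] i ∈
        ⨆ i, Submodule.span ℝ {![G p (1, 0, 0), G p (0, 1, 0), G p (0, 0, 1)] i} := fun i =>
      Submodule.mem_iSup_of_mem i (Submodule.mem_span_singleton_self _)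
    exact add_mem (add_mem (Submodule.smul_mem _ _ (hm 0)) (Submodule.smul_mem _ _ (hm 1)))
      (Submodule.smul_mem _ _ (hm 2))

/-- Two-sided exponential bounds at the rate `r` determine the exponent `log r`. -/
theorem tendsto_log_of_le_of_le {x : ℕ → ℝ} {A B r : ℝ} (hA : 0 < A) (hr : 0 < r)
    (h1 : ∀ n, A * r ^ n ≤ x n) (h2 : ∀ n, x n ≤ B * r ^ n) :
    Tendsto (fun n : ℕ => 1 / (n : ℝ) * Real.log (x n)) atTop (𝓝 (Real.log r)) := by
  have hB : 0 < B := by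
    have := (h1 0).trans (h2 0)
    simp only [pow_zero, mul_one] at this
    exact hA.trans_le this
  have hlim : ∀ D : ℝ, Tendsto (fun n : ℕ => 1 / (n : ℝ) * Real.log D + Real.log r) atTop
      (𝓝 (Real.log r)) := fun D => by
    simpa using (tendsto_one_div_atTop_nhds_zero_nat.mul_const (Real.log D)).add_const (Real.log r)
  have hlog : ∀ (D : ℝ), 0 < D → ∀ n : ℕ, 0 < n →
      1 / (n : ℝ) * Real.log (D * r ^ n) = 1 / (n : ℝ) * Real.log D + Real.log r := by
    intro D hD n hn
    have hn' : (n : ℝ) ≠ 0 := by exact_mod_cast hn.ne'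
    rw [Real.log_mul hD.ne' (pow_pos hr n).ne', Real.log_pow]
    field_simp
  refine tendsto_of_tendsto_of_tendsto_of_le_of_le' (hlim A) (hlim B) ?_ ?_
  · filter_upwards [eventually_gt_atTop 0] with n hn
    rw [← hlog A hA n hn]
    gcongr
    exact h1 n
  · filter_upwards [eventually_gt_atTop 0] with n hn
    rw [← hlog B hB n hn]
    have : 0 < x n := lt_of_lt_of_le (by positivity) (h1 n)
    gcongr
    exact h2 n

namespace IsDiagonalIn

variable {f : Nilmanifold → Nilmanifold} {L : ∀ p, TpN p →ₗ[ℝ] TpN (f p)}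
  {G : ∀ p, R3 ≃ₗ[ℝ] TpN p} {a b c : ℝ}

theorem iterate_apply (h : IsDiagonalIn L G a b c) (n : ℕ) (p : Nilmanifold) (w : R3) :
    (total L)^[n] ⟨p, G p w⟩ = ⟨f^[n] p, G (f^[n] p) (diag (a ^ n) (b ^ n) (c ^ n) w)⟩ := by
  induction n with
  | zero =>
    simp only [diag, pow_zero, one_mul]
    rfl
  | succ n ih =>
    rw [Function.iterate_succ_apply', ih]
    change (⟨f (f^[n] p), L (f^[n] p) (G (f^[n] p) _)⟩ : TN) = _
    rw [h.apply_frame, Function.iterate_succ_apply' f n p]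
    simp only [diag, pow_succ', mul_assoc]

theorem isLinearCocycle (h : IsDiagonalIn L G a b c) (ha : a ≠ 0) (hb : b ≠ 0) (hc : c ≠ 0) :
    IsLinearCocycle L where
  continuous := by
    have h1 : Continuous (diag a b c) := by unfold diag; fun_prop
    have h2 := h.continuous_frame.comp ((h.continuous_base.comp
      (FiberBundle.continuous_proj R3 TpN)).prodMk (h1.comp h.continuous_symm))
    refine h2.congr fun ξ => ?_
    change (⟨f ξ.1, G (f ξ.1) (diag a b c ((G ξ.1).symm ξ.2))⟩ : TN) = ⟨f ξ.1, L ξ.1 ξ.2⟩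
    rw [← h.apply_frame, LinearEquiv.apply_symm_apply]
  bijective p := by
    have hinj : Function.Injective (L p) := by
      intro v w hvw
      obtain ⟨v, rfl⟩ := (G p).surjective v
      obtain ⟨w, rfl⟩ := (G p).surjective w
      rw [h.apply_frame, h.apply_frame] at hvw
      have := (G (f p)).injective hvw
      simp only [diag, Prod.mk.injEq, mul_right_inj' ha, mul_right_inj' hb,
        mul_right_inj' hc] at this
      rw [Prod.ext this.1 (Prod.ext this.2.1 this.2.2)]
    refine ⟨hinj, fun v => ?_⟩
    obtain ⟨w, rfl⟩ := (G (f p)).surjective v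
    refine ⟨G p (diag a⁻¹ b⁻¹ c⁻¹ w), ?_⟩
    rw [h.apply_frame]
    simp [diag, ha, hb, hc]

theorem isContinuousLineBundle (h : IsDiagonalIn L G a b c) {w : R3} (hw : w ≠ 0) :
    IsContinuousLineBundle (frameLine G w) := fun _ =>
  ⟨fun q => G q w, Set.univ, univ_mem,
    (h.continuous_frame.comp (continuous_id.prodMk continuous_const)).continuousOn,
    fun q _ => ⟨(G q).map_ne_zero_iff.2 hw, rfl⟩⟩

theorem map_frameLine (h : IsDiagonalIn L G a b c) {w : R3} {r : ℝ} (hr : r ≠ 0)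
    (hw : diag a b c w = r • w) (p : Nilmanifold) :
    (frameLine G w p).map (L p) = frameLine G w (f p) := by
  rw [frameLine, Submodule.map_span, Set.image_singleton, h.apply_frame, hw, map_smul]
  exact Submodule.span_singleton_smul_eq (isUnit_iff_ne_zero.2 hr) _

/-- By compactness of `N`, every Riemannian metric is uniformly comparable with the norm of the
coordinates in the frame. -/
theorem exists_nrm_bounds (h : IsDiagonalIn L G a b c) (g : Metric) :
    ∃ K : ℝ, 0 < K ∧ ∀ p w, g.nrm ⟨p, G p w⟩ ≤ K * ‖w‖ ∧ ‖w‖ ≤ K * g.nrm ⟨p, G p w⟩ := by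
  have hcpt : IsCompact (Set.univ ×ˢ Metric.sphere 0 1 : Set (Nilmanifold × R3)) :=
    isCompact_univ.prod (isCompact_sphere 0 1)
  have hcont : Continuous fun q : Nilmanifold × R3 => g.nrm ⟨q.1, G q.1 q.2⟩ :=
    g.continuous_nrm.comp h.continuous_frame
  have hpos : ∀ p, ∀ w : R3, w ≠ 0 → 0 < g.nrm ⟨p, G p w⟩ := fun p w hw =>
    g.nrm_pos p ((G p).map_ne_zero_iff.2 hw)
  -- Upper bounds for the norm and its inverse on the unit sphere bundle, extended by homogeneity.
  obtain ⟨C₁, hC₁⟩ := hcpt.exists_bound_of_continuousOn hcont.continuousOn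
  obtain ⟨C₂, hC₂⟩ := hcpt.exists_bound_of_continuousOn
    (f := fun q : Nilmanifold × R3 => (g.nrm ⟨q.1, G q.1 q.2⟩)⁻¹) (hcont.continuousOn.inv₀ (by
      rintro ⟨p, w⟩ hw
      exact (hpos p w (ne_zero_of_mem_unit_sphere ⟨w, hw.2⟩)).ne'))
  refine ⟨max 1 (max C₁ C₂), by positivity, fun p w => ?_⟩
  rcases eq_or_ne w 0 with rfl | hw
  · have h0 : g.nrm ⟨p, 0⟩ = 0 := by simpa using g.nrm_smul p 0 0
    rw [map_zero, h0]
    simp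
  have hn : 0 < ‖w‖ := norm_pos_iff.2 hw
  set u : R3 := ‖w‖⁻¹ • w with hu
  have hu1 : ((p, u) : Nilmanifold × R3) ∈ (Set.univ ×ˢ Metric.sphere 0 1) := by
    refine ⟨trivial, ?_⟩
    simp [hu, norm_smul, hn.ne']
  have hu0 : u ≠ 0 := ne_zero_of_mem_unit_sphere ⟨u, hu1.2⟩
  have hwu : g.nrm ⟨p, G p w⟩ = ‖w‖ * g.nrm ⟨p, G p u⟩ := by
    have : w = ‖w‖ • u := by rw [hu, smul_smul, mul_inv_cancel₀ hn.ne', one_smul]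
    conv_lhs => rw [this, map_smul, g.nrm_smul, abs_norm]
  have b1 : g.nrm ⟨p, G p u⟩ ≤ max 1 (max C₁ C₂) :=
    ((le_abs_self _).trans (hC₁ _ hu1)).trans ((le_max_left _ _).trans (le_max_right _ _))
  have b2 : (g.nrm ⟨p, G p u⟩)⁻¹ ≤ max 1 (max C₁ C₂) :=
    ((le_abs_self _).trans (hC₂ _ hu1)).trans ((le_max_right _ _).trans (le_max_right _ _))
  have b3 : 1 ≤ max 1 (max C₁ C₂) * g.nrm ⟨p, G p u⟩ :=
    (inv_le_iff_one_le_mul₀ (hpos p u hu0)).1 b2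
  rw [hwu]
  constructor
  · rw [mul_comm]
    gcongr
  · nlinarith

/-- A nonzero vector whose coordinates grow exactly at the rate `r` has exponent `log r`. -/
theorem hasLyapunovExponent (h : IsDiagonalIn L G a b c) (g : Metric) {r A B : ℝ} (hr : 0 < r)
    (hA : 0 < A) {w : R3} (h1 : ∀ n : ℕ, A * r ^ n ≤ ‖diag (a ^ n) (b ^ n) (c ^ n) w‖)
    (h2 : ∀ n : ℕ, ‖diag (a ^ n) (b ^ n) (c ^ n) w‖ ≤ B * r ^ n) (p : Nilmanifold) :
    HasLyapunovExponent g (total L) ⟨p, G p w⟩ (Real.log r) := by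
  obtain ⟨K, hK, hb⟩ := h.exists_nrm_bounds g
  refine tendsto_log_of_le_of_le (A := K⁻¹ * A) (B := K * B) (by positivity) hr (fun n => ?_)
    fun n => ?_
  · rw [h.iterate_apply, mul_assoc, inv_mul_le_iff₀ hK]
    exact (h1 n).trans (hb _ _).2
  · rw [h.iterate_apply, mul_assoc]
    exact (hb _ _).1.trans (mul_le_mul_of_nonneg_left (h2 n) hK.le)

theorem hasLyapunovExponent_of_diag_eq_smul (h : IsDiagonalIn L G a b c) (g : Metric) {r : ℝ}
    (hr : 0 < r) {w : R3} (hw : w ≠ 0) (hd : ∀ n : ℕ, diag (a ^ n) (b ^ n) (c ^ n) w = r ^ n • w)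
    (p : Nilmanifold) : HasLyapunovExponent g (total L) ⟨p, G p w⟩ (Real.log r) := by
  have hn : ∀ n : ℕ, ‖diag (a ^ n) (b ^ n) (c ^ n) w‖ = ‖w‖ * r ^ n := fun n => by
    rw [hd, norm_smul, Real.norm_of_nonneg (pow_pos hr n).le, mul_comm]
  exact h.hasLyapunovExponent g hr (norm_pos_iff.2 hw) (fun n => (hn n).ge) (fun n => (hn n).le) p

/-- The exponent of a nonzero vector is the logarithm of the largest eigenvalue among those whose
coordinate of the vector does not vanish. -/
theorem exists_hasLyapunovExponent (h : IsDiagonalIn L G a b c) (g : Metric) (ha : 0 < a)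
    (hab : a < b) (hbc : b < c) (p : Nilmanifold) {v : TpN p} (hv : v ≠ 0) :
    ∃ r ∈ ({a, b, c} : Set ℝ), HasLyapunovExponent g (total L) ⟨p, v⟩ (Real.log r) := by
  obtain ⟨⟨x, y, z⟩, rfl⟩ := (G p).surjective v
  have hw : ((x, y, z) : R3) ≠ 0 := fun h0 => hv (by rw [h0, map_zero])
  have hb : 0 < b := ha.trans hab
  have hc : 0 < c := hb.trans hbc
  have hnorm : ∀ n : ℕ, ‖diag (a ^ n) (b ^ n) (c ^ n) (x, y, z)‖ =
      max (|x| * a ^ n) (max (|y| * b ^ n) (|z| * c ^ n)) := fun n => by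
    simp only [diag, Prod.norm_def, Real.norm_eq_abs, abs_mul, abs_pow, abs_of_pos ha,
      abs_of_pos hb, abs_of_pos hc, mul_comm |x|, mul_comm |y|, mul_comm |z|]
  have hx : |x| ≤ ‖((x, y, z) : R3)‖ := norm_fst_le (x, y, z)
  have hy : |y| ≤ ‖((x, y, z) : R3)‖ :=
    (norm_fst_le (y, z)).trans (norm_snd_le ((x, y, z) : R3))
  have hz : |z| ≤ ‖((x, y, z) : R3)‖ :=
    (norm_snd_le (y, z)).trans (norm_snd_le ((x, y, z) : R3))
  by_cases hz0 : z = 0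
  · by_cases hy0 : y = 0
    · subst hz0 hy0
      refine ⟨a, by simp, h.hasLyapunovExponent_of_diag_eq_smul g ha hw (fun n => ?_) p⟩
      simp [diag]
    · subst hz0
      refine ⟨b, by simp, h.hasLyapunovExponent g hb (abs_pos.2 hy0)
        (B := ‖((x, y, 0) : R3)‖) (fun n => ?_) (fun n => ?_) p⟩ <;> rw [hnorm]
      · exact (le_max_left _ _).trans (le_max_right _ _)
      · rw [abs_zero, zero_mul]
        refine max_le ?_ (max_le ?_ (by positivity)) <;> gcongr
  · refine ⟨c, by simp, h.hasLyapunovExponent g hc (abs_pos.2 hz0)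
      (B := ‖((x, y, z) : R3)‖) (fun n => ?_) (fun n => ?_) p⟩ <;> rw [hnorm]
    · exact (le_max_right _ _).trans (le_max_right _ _)
    · have hac : a < c := hab.trans hbc
      refine max_le ?_ (max_le ?_ ?_) <;> gcongr

/-- Along an eigenvector of the diagonal matrix, the cocycle expands at the rate of the
eigenvalue, up to a constant that depends on the metric only. -/
theorem exists_nrm_iterate_bounds (h : IsDiagonalIn L G a b c) (g : Metric) :
    ∃ K : ℝ, 0 < K ∧ ∀ (r : ℝ) (w : R3), 0 < r →
      (∀ n : ℕ, diag (a ^ n) (b ^ n) (c ^ n) w = r ^ n • w) →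
      ∀ p, ∀ v ∈ frameLine G w p, ∀ n : ℕ,
        g.nrm ((total L)^[n] ⟨p, v⟩) ≤ K * r ^ n * g.nrm ⟨p, v⟩ ∧
        r ^ n * g.nrm ⟨p, v⟩ ≤ K * g.nrm ((total L)^[n] ⟨p, v⟩) := by
  obtain ⟨K, hK, hb⟩ := h.exists_nrm_bounds g
  refine ⟨K * K, by positivity, fun r w hr hd p v hv n => ?_⟩
  obtain ⟨t, rfl⟩ := (mem_frameLine G).1 hv
  have hrn : 0 < r ^ n := pow_pos hr n
  have hdt : diag (a ^ n) (b ^ n) (c ^ n) (t • w) = r ^ n • t • w := by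
    rw [smul_comm, ← hd]
    simp only [diag, Prod.smul_fst, Prod.smul_snd, Prod.smul_mk, smul_eq_mul, mul_left_comm]
  rw [h.iterate_apply, hdt]
  have h1 := hb p (t • w)
  have h2 := hb (f^[n] p) (r ^ n • t • w)
  rw [norm_smul (r ^ n), Real.norm_of_nonneg hrn.le] at h2
  constructor
  · calc _ ≤ K * (r ^ n * ‖t • w‖) := h2.1
      _ ≤ K * (r ^ n * (K * g.nrm ⟨p, G p (t • w)⟩)) := by gcongr; exact h1.2
      _ = _ := by ring
  · calc _ ≤ r ^ n * (K * ‖t • w‖) := by gcongr; exact h1.1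
      _ = K * (r ^ n * ‖t • w‖) := by ring
      _ ≤ K * (K * g.nrm ⟨f^[n] p, G (f^[n] p) (r ^ n • t • w)⟩) :=
        mul_le_mul_of_nonneg_left h2.2 hK.le
      _ = _ := by ring

theorem isPartiallyHyperbolic (h : IsDiagonalIn L G a b c) (g : Metric) (ha : 0 < a)
    (ha1 : a < 1) (hab : a < b) (hbc : b < c) (hc1 : 1 < c) :
    IsPartiallyHyperbolic g L (frameLine G (1, 0, 0)) (frameLine G (0, 1, 0))
      (frameLine G (0, 0, 1)) := by
  have hb : 0 < b := ha.trans hab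
  have hc : 0 < c := hb.trans hbc
  obtain ⟨K, hK, hbd⟩ := h.exists_nrm_iterate_bounds g
  have hs := hbd a (1, 0, 0) ha (by simp [diag])
  have hm := hbd b (0, 1, 0) hb (by simp [diag])
  have hu := hbd c (0, 0, 1) hc (by simp [diag])
  -- Domination with ratio `r / t < 1` of a bundle of rate `r` by one of rate `t`.
  have key : ∀ {r t ρ X X' Y Y' : ℝ} (n : ℕ), 0 < r → 0 < t → r / t ≤ ρ → 0 ≤ X → 0 ≤ Y →
      0 ≤ Y' → X' ≤ K * r ^ n * X → t ^ n * Y ≤ K * Y' →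
      X' * Y ≤ K ^ 2 * ρ ^ n * (Y' * X) := by
    intro r t ρ X X' Y Y' n hr ht hρ hX hY hY' h1 h2
    have hρ0 : 0 ≤ ρ := (div_pos hr ht).le.trans hρ
    calc X' * Y ≤ K * r ^ n * X * Y := by gcongr
      _ = K * (r / t) ^ n * X * (t ^ n * Y) := by
        rw [div_pow]
        field_simp
      _ ≤ K * ρ ^ n * X * (K * Y') := by gcongr
      _ = K ^ 2 * ρ ^ n * (Y' * X) := by ring
  set ρ := max a (max c⁻¹ (max (a / b) (b / c))) with hρ
  have hρ1 : a ≤ ρ := le_max_left _ _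
  have hρ2 : c⁻¹ ≤ ρ := (le_max_left _ _).trans (le_max_right _ _)
  have hρ3 : a / b ≤ ρ := (le_max_left _ _).trans ((le_max_right _ _).trans (le_max_right _ _))
  have hρ4 : b / c ≤ ρ := (le_max_right _ _).trans ((le_max_right _ _).trans (le_max_right _ _))
  have hρ0 : 0 < ρ := ha.trans_le hρ1
  refine
    { cocycle := h.isLinearCocycle ha.ne' hb.ne' hc.ne'
      continuous_s := h.isContinuousLineBundle (by simp)
      continuous_c := h.isContinuousLineBundle (by simp)
      continuous_u := h.isContinuousLineBundle (by simp)
      splitting := isInternal_frameLine G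
      invariant_s := h.map_frameLine ha.ne' (by simp [diag])
      invariant_c := h.map_frameLine hb.ne' (by simp [diag])
      invariant_u := h.map_frameLine hc.ne' (by simp [diag])
      estimates := ⟨max K (K ^ 2), ρ, by positivity, hρ0, ?_, fun p n => ⟨?_, ?_, ?_, ?_⟩⟩ }
  · exact max_lt ha1 (max_lt (inv_lt_one_of_one_lt₀ hc1)
      (max_lt ((div_lt_one hb).2 hab) ((div_lt_one hc).2 hbc)))
  · intro v hv
    refine (hs p v hv n).1.trans ?_
    have := g.nrm_nonneg ⟨p, v⟩
    gcongr
    exact le_max_left _ _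
  · intro v hv
    have h0 := g.nrm_nonneg ((total L)^[n] ⟨p, v⟩)
    calc g.nrm ⟨p, v⟩ = c⁻¹ ^ n * (c ^ n * g.nrm ⟨p, v⟩) := by
          rw [inv_pow, inv_mul_cancel_left₀ (pow_pos hc n).ne']
      _ ≤ ρ ^ n * (K * g.nrm ((total L)^[n] ⟨p, v⟩)) :=
        mul_le_mul (pow_le_pow_left₀ (by positivity) hρ2 n) (hu p v hv n).2
          (mul_nonneg (by positivity) (g.nrm_nonneg _)) (by positivity)
      _ = K * ρ ^ n * g.nrm ((total L)^[n] ⟨p, v⟩) := by ring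
      _ ≤ _ := by
        gcongr
        exact le_max_left _ _
  · intro v hv w hw
    refine (key n ha hb hρ3 (g.nrm_nonneg _) (g.nrm_nonneg _) (g.nrm_nonneg _)
      (hs p v hv n).1 (hm p w hw n).2).trans ?_
    have := mul_nonneg (g.nrm_nonneg ((total L)^[n] ⟨p, w⟩)) (g.nrm_nonneg ⟨p, v⟩)
    gcongr
    exact le_max_right _ _
  · intro v hv w hw
    refine (key n hb hc hρ4 (g.nrm_nonneg _) (g.nrm_nonneg _) (g.nrm_nonneg _)
      (hm p v hv n).1 (hu p w hw n).2).trans ?_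
    have := mul_nonneg (g.nrm_nonneg ((total L)^[n] ⟨p, w⟩)) (g.nrm_nonneg ⟨p, v⟩)
    gcongr
    exact le_max_right _ _

end IsDiagonalIn

/-! ### Diagonalization of the rotated cocycle -/

/-- For small positive `θ` the matrix of `F_θ` on `E^cu` has two eigenvalues larger than `1`. They
are the roots of the characteristic polynomial `X² - (λ + 1) cos θ X + λ` with `λ = (3 + √5)/2`. -/
theorem exists_centerUnstable_eigenvalues {θ : ℝ} (h0 : 0 < θ) (h1 : θ < 2 / 5) :
    ∃ μ ν : ℝ, 1 < μ ∧ μ < ν ∧ μ + ν = ((3 + √5) / 2 + 1) * Real.cos θ ∧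
      μ * ν = (3 + √5) / 2 := by
  have hc : 23 / 25 ≤ Real.cos θ := by
    have := Real.one_sub_sq_div_two_le_cos (x := θ)
    nlinarith
  have hc1 : Real.cos θ < 1 := by
    have := Real.cos_lt_cos_of_nonneg_of_le_pi le_rfl (by linarith [Real.pi_gt_three]) h0
    rwa [Real.cos_zero] at this
  have h5 : (2.236 : ℝ) < √5 := Real.lt_sqrt_of_sq_lt (by norm_num)
  have h5' : √5 < (2.237 : ℝ) := (Real.sqrt_lt' (by norm_num)).2 (by norm_num)
  set l : ℝ := (3 + √5) / 2 with hl
  set T : ℝ := (l + 1) * Real.cos θ with hT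
  have hT1 : T < l + 1 := by nlinarith
  have hT2 : 3.328 < T := by nlinarith
  have hD : 0 < T ^ 2 - 4 * l := by nlinarith
  have hs := Real.sq_sqrt hD.le
  have hs0 : 0 < √(T ^ 2 - 4 * l) := Real.sqrt_pos.2 hD
  have hs1 : √(T ^ 2 - 4 * l) < T - 2 := (Real.sqrt_lt' (by linarith)).2 (by nlinarith)
  exact ⟨(T - √(T ^ 2 - 4 * l)) / 2, (T + √(T ^ 2 - 4 * l)) / 2, by linarith, by linarith,
    by ring, by linear_combination (-1 / 4 : ℝ) * hs⟩

/-- The linear map with columns `(1, 0, 0)`, `(0, s, t - μ)` and `(0, s, t - ν)`. -/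
def eigenbasisMap (s t μ ν : ℝ) : R3 →ₗ[ℝ] R3 where
  toFun w := (w.1, s * (w.2.1 + w.2.2), (t - μ) * w.2.1 + (t - ν) * w.2.2)
  map_add' v w := by ext <;> simp <;> ring
  map_smul' a w := by ext <;> simp <;> ring

theorem eigenbasisMap_injective {s t μ ν : ℝ} (hs : s ≠ 0) (hμν : μ ≠ ν) :
    Function.Injective (eigenbasisMap s t μ ν) := by
  rw [injective_iff_map_eq_zero]
  rintro ⟨x, y, z⟩ hw
  simp only [eigenbasisMap, LinearMap.coe_mk, AddHom.coe_mk, Prod.mk_eq_zero, mul_eq_zero,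
    hs, false_or] at hw ⊢
  obtain ⟨hx, h1, h2⟩ := hw
  have hz : z = -y := by linarith
  subst hz
  have hy : y * (ν - μ) = 0 := by linear_combination h2
  have hy0 : y = 0 := (mul_eq_zero.1 hy).resolve_right (sub_ne_zero.2 hμν.symm)
  simp [hx, hy0]

/-- The basis of `ℝ³` formed by the columns of `eigenbasisMap`. For `s = λ sin θ` and
`t = λ cos θ` these are eigenvectors of the matrix of `F_θ`. -/
def eigenbasis {s t μ ν : ℝ} (hs : s ≠ 0) (hμν : μ ≠ ν) : R3 ≃ₗ[ℝ] R3 :=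
  LinearEquiv.ofInjectiveOfFinrankEq (eigenbasisMap s t μ ν) (eigenbasisMap_injective hs hμν) rfl

theorem eigenbasis_apply {s t μ ν : ℝ} (hs : s ≠ 0) (hμν : μ ≠ ν) (w : R3) :
    eigenbasis (t := t) hs hμν w =
      (w.1, s * (w.2.1 + w.2.2), (t - μ) * w.2.1 + (t - ν) * w.2.2) := rfl

theorem Eigenvectors.rotatedDeriv_frame (e : Eigenvectors) (θ : ℝ) (p : Nilmanifold) (w : R3) :
    e.rotatedDeriv θ p (e.frame p w) = e.frame (nilDiffeo p)
      (diag ((3 - √5) / 2) ((3 + √5) / 2) 1 (rot θ w)) := by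
  have h1 : e.rotatedDeriv θ p (e.frame p w) =
      mfderiv 𝓘(ℝ, R3) 𝓘(ℝ, R3) nilDiffeo p
        (e.frame p (rot θ ((e.frame p).symm (e.frame p w)))) := rfl
  rw [h1, LinearEquiv.symm_apply_apply, e.mfderiv_nilDiffeo_frame, diag, one_mul]

/-- A frame that differs from the invariant frame by a constant change of basis to eigenvectors
diagonalizes `F_θ`. -/
theorem Eigenvectors.isDiagonalIn_rotatedDeriv (e : Eigenvectors) {θ μ ν : ℝ}
    (hs : (3 + √5) / 2 * Real.sin θ ≠ 0) (hμν : μ ≠ ν)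
    (hsum : μ + ν = ((3 + √5) / 2 + 1) * Real.cos θ) (hprod : μ * ν = (3 + √5) / 2) :
    IsDiagonalIn (e.rotatedDeriv θ)
      (fun p => eigenbasis (t := (3 + √5) / 2 * Real.cos θ) hs hμν ≪≫ₗ e.frame p)
      ((3 - √5) / 2) μ ν where
  continuous_base := nilDiffeo.continuous
  continuous_frame := by
    have h1 : Continuous (eigenbasis (t := (3 + √5) / 2 * Real.cos θ) hs hμν) :=
      LinearMap.continuous_of_finiteDimensional (LinearEquiv.toLinearMap _)
    exact e.continuous_frame.comp (continuous_fst.prodMk (h1.comp continuous_snd))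
  continuous_symm := by
    have h1 : Continuous (eigenbasis (t := (3 + √5) / 2 * Real.cos θ) hs hμν).symm :=
      LinearMap.continuous_of_finiteDimensional (LinearEquiv.toLinearMap _)
    exact h1.comp e.continuous_frame_symm
  apply_frame p w := by
    rw [LinearEquiv.trans_apply, LinearEquiv.trans_apply, e.rotatedDeriv_frame, eigenbasis_apply,
      eigenbasis_apply]
    congr 1
    have hcs := Real.sin_sq_add_cos_sq θ
    simp only [rot, diag, LinearMap.coe_mk, AddHom.coe_mk, Prod.mk.injEq, true_and, one_mul]
    constructor
    · ring
    · linear_combination (w.2.1 + w.2.2) * (3 + √5) / 2 * hcs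
        + (μ * w.2.1 + ν * w.2.2) * hsum - (w.2.1 + w.2.2) * hprod

/-- Both sides consist of the vectors whose first coordinate in the invariant frame vanishes. -/
theorem Eigenvectors.frameLine_sup_frameLine (e : Eigenvectors) {s t μ ν : ℝ} (hs : s ≠ 0)
    (hμν : μ ≠ ν) (p : Nilmanifold) :
    frameLine (fun p => eigenbasis (t := t) hs hμν ≪≫ₗ e.frame p) (0, 1, 0) p ⊔
      frameLine (fun p => eigenbasis (t := t) hs hμν ≪≫ₗ e.frame p) (0, 0, 1) p =
      e.centerUnstable p := by
  have hcomb : ∀ y z : ℝ, e.frame p (0, y, z) =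
      y • e.frame p (0, 1, 0) + z • e.frame p (0, 0, 1) := fun y z => by
    rw [← map_smul, ← map_smul, ← map_add]
    simp
  apply le_antisymm
  · simp only [frameLine, sup_le_iff, Submodule.span_singleton_le_iff_mem, centerUnstable,
      LinearEquiv.trans_apply, eigenbasis_apply]
    exact ⟨Submodule.mem_span_pair.2 ⟨_, _, (hcomb _ _).symm⟩,
      Submodule.mem_span_pair.2 ⟨_, _, (hcomb _ _).symm⟩⟩
  · have hmem : ∀ y z : ℝ, e.frame p (0, y, z) ∈
        frameLine (fun p => eigenbasis (t := t) hs hμν ≪≫ₗ e.frame p) (0, 1, 0) p ⊔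
        frameLine (fun p => eigenbasis (t := t) hs hμν ≪≫ₗ e.frame p) (0, 0, 1) p := by
      intro y z
      obtain ⟨⟨a, b, c⟩, hw⟩ := (eigenbasis (t := t) hs hμν).surjective (0, y, z)
      have ha : a = 0 := congrArg Prod.fst hw
      have hsplit : ((a, b, c) : R3) = b • (0, 1, 0) + c • (0, 0, 1) := by simp [ha]
      rw [← hw, hsplit, map_add, map_add, map_smul, map_smul, map_smul, map_smul]
      exact add_mem
        (Submodule.mem_sup_left (Submodule.smul_mem _ _ (Submodule.mem_span_singleton_self _)))
        (Submodule.mem_sup_right (Submodule.smul_mem _ _ (Submodule.mem_span_singleton_self _)))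
    rw [centerUnstable, Submodule.span_le]
    rintro v (rfl | rfl)
    exacts [hmem 1 0, hmem 0 1]

end HeisNil

end

theorem mainTheorem5 (e : HeisNil.Eigenvectors) :
    ∃ I : Set ℝ, IsOpen I ∧ I.Nonempty ∧ I ⊆ Set.Icc 0 (2 * Real.pi) ∧ ∀ θ ∈ I,
      ∃ Ec Eu : ∀ p : HeisNil.Nilmanifold, Submodule ℝ (HeisNil.TpN p),
        (∀ p, Ec p ⊔ Eu p = e.centerUnstable p) ∧
        ∃ lc : ℝ, 0 < lc ∧ ∀ g : HeisNil.Metric,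
          HeisNil.IsPartiallyHyperbolic g (e.rotatedDeriv θ) e.stable Ec Eu ∧
          HeisNil.IsNonuniformlyHyperbolic g HeisNil.lebesgueNil
            (HeisNil.total (e.rotatedDeriv θ)) ∧
          ∀ᵐ p ∂HeisNil.lebesgueNil, ∀ v ∈ Ec p, v ≠ 0 →
            HeisNil.HasLyapunovExponent g (HeisNil.total (e.rotatedDeriv θ)) ⟨p, v⟩ lc := by
  refine ⟨Set.Ioo 0 (2 / 5), isOpen_Ioo, ⟨1 / 5, by norm_num, by norm_num⟩, fun θ hθ =>
    ⟨hθ.1.le, by linarith [hθ.2, Real.pi_gt_three]⟩, fun θ hθ => ?_⟩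
  obtain ⟨μ, ν, h1, h2, hsum, hprod⟩ := HeisNil.exists_centerUnstable_eigenvalues hθ.1 hθ.2
  have hsin : 0 < Real.sin θ :=
    Real.sin_pos_of_pos_of_lt_pi hθ.1 (by linarith [hθ.2, Real.pi_gt_three])
  have hs : (3 + √5) / 2 * Real.sin θ ≠ 0 := by positivity
  have h5 : 1 < √5 := Real.lt_sqrt_of_sq_lt (by norm_num)
  have h5' : √5 < 3 := (Real.sqrt_lt' (by norm_num)).2 (by norm_num)
  have hd := e.isDiagonalIn_rotatedDeriv hs h2.ne hsum hprod
  have ha0 : 0 < (3 - √5) / 2 := by linarith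
  have ha1 : (3 - √5) / 2 < 1 := by linarith
  have hstable : e.stable = HeisNil.frameLine (fun p => HeisNil.eigenbasis
      (t := (3 + √5) / 2 * Real.cos θ) hs h2.ne ≪≫ₗ e.frame p) (1, 0, 0) := by
    funext p
    simp only [HeisNil.frameLine, HeisNil.Eigenvectors.stable, LinearEquiv.trans_apply,
      HeisNil.eigenbasis_apply, add_zero, mul_zero]
  refine ⟨_, _, e.frameLine_sup_frameLine (t := (3 + √5) / 2 * Real.cos θ) hs h2.ne, Real.log μ,
    Real.log_pos h1, fun g => ⟨?_, ?_, ?_⟩⟩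
  · rw [hstable]
    exact hd.isPartiallyHyperbolic g ha0 ha1 (ha1.trans h1) h2 (h1.trans h2)
  · refine Filter.Eventually.of_forall fun p v hv => ?_
    obtain ⟨r, hr, hl⟩ := hd.exists_hasLyapunovExponent g ha0 (ha1.trans h1) h2 p hv
    refine ⟨Real.log r, ?_, hl⟩
    rcases hr with rfl | rfl | rfl
    exacts [(Real.log_neg ha0 ha1).ne, (Real.log_pos h1).ne', (Real.log_pos (h1.trans h2)).ne']
  · refine Filter.Eventually.of_forall fun p v hv hv0 => ?_
    obtain ⟨t, rfl⟩ := (HeisNil.mem_frameLine _).1 hv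
    have ht : t • ((0, 1, 0) : HeisNil.R3) ≠ 0 := fun h => hv0 (by rw [h, map_zero])
    exact hd.hasLyapunovExponent_of_diag_eq_smul g (by linarith) ht
      (fun n => by simp [HeisNil.diag]) p
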